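/- Let $S$ be a finite alphabet with the discrete topology. A *pattern* is a map $s : D \to S$ with $D \subset \mathbb{Z}^d$ finite; it *occurs* in $x \in S^{\mathbb{Z}^d}$ if for some $\vec n \in \mathbb{Z}^d$ we have $x_{\vec n + \vec m} = s_{\vec m}$ for all $\vec m \in D$. Let $\mathcal{B}(x)$ be the set of patterns occurring in $x$. A *subshift* is a closed, translation-invariant set $X \subset S^{\mathbb{Z}^d}$; it is *of finite type* (an SFT) if, for some finite set of patterns, $X$ is the set of all configurations in which none of them occurs. Two subshifts (over possibly different finite alphabets) are *conjugate* if there is a continuous bijection between them that commutes with all translations. Let $X \subset S^{\mathbb{Z}^2}$ be a subshift. * *Determinism.* A set $Z \subset S^{\mathbb{Z}^2}$ is *southward deterministic* if for every $x \in S^{\mathbb{Z}^2}$ at most one $y \in Z$ agrees with $x$ on $\{(a,b) \in \mathbb{Z}^2 : b \ge 1\}$. For $A \in SL_2(\mathbb{Z})$ put $A(x)_{\vec n} = x_{A^{-1}\vec n}$ and $A(X) = \{A(x) : x \in X\}$. For $\vec d = (d_1, d_2) \in \mathbb{Z}^2$ with $\gcd(d_1, d_2) = 1$, $X$ is *deterministic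 in the direction $\vec d$* if $A(X)$ is southward deterministic, where $A \in SL_2(\mathbb{Z})$ satisfies $A(-d_2, d_1) = (1, 0)$ (the choice of such an $A$ does not matter). $X$ is *deterministic* if it is deterministic in some direction. * *P property.* The rows of $X$ are the configurations $(x_{(j,0)})_{j \in \mathbb{Z}} \in S^{\mathbb{Z}}$, $x \in X$. $X$ has the *P property* if some subshift $X'$ conjugate to $X$ has all its rows in a countable one-dimensional SFT. * *Subpattern poset.* $SP(X)$ is the partially ordered set obtained from the preorder $x \le y :\Leftrightarrow \mathcal{B}(x) \subset \mathcal{B}(y)$ on $X$ by identifying $x$ and $y$ whenever $x \le y$ and $y \le x$. **Theorem.** Let $P$ be a finite poset. There exist a finite alphabet $S$ and a countable deterministic SFT $X \subset S^{\mathbb{Z}^2}$ that has the P property, and whose own rows are all contained in a countable one-dimensional SFT, such that $P$ can be order-embedded in $SP(X)$; that is, there is an injective map $\phi : P \to SP(X)$ with $p \le q$ if and only if $\phi(p) \le \phi(q)$, for all $p, q \in P$. -/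

import Mathlib

namespace SFTPoset

open SymbolicDynamics.FullShift

/-- The group `ℤ²`; the coordinates of `n` are `n 0` (to the right) and `n 1` (upward). -/
abbrev Z2 : Type := Fin 2 → ℤ

section General

variable {S T G : Type*} [AddMonoid G]

/-- A subshift is of finite type if it is the set of all configurations that avoid some finite
set of forbidden patterns. -/
def IsSFT [Inhabited S] [TopologicalSpace S] (X : Subshift S G) : Prop :=
  ∃ F : Set (Pattern S G), F.Finite ∧ X.carrier = forbidden F

/-- The set `B(x)` of all (finite) patterns that occur in the configuration `x`. -/
def patternsOf [Inhabited S] (x : G → S) : Set (Pattern S G) :=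
  {p | ∃ g : G, p.occursInAt x g}

/-- `f` is a block map between subshifts: continuous, and it commutes with all translations. -/
def IsBlockMap [TopologicalSpace S] [TopologicalSpace T]
    (X : Subshift S G) (Y : Subshift T G) (f : X.carrier → Y.carrier) : Prop :=
  Continuous f ∧
    ∀ (g : G) (x : X.carrier), (f ⟨shift g x.1, X.mapsTo g x.2⟩).1 = shift g (f x).1

/-- Two subshifts are conjugate if there is a bijective block map between them. -/
def Conjugate [TopologicalSpace S] [TopologicalSpace T]
    (X : Subshift S G) (Y : Subshift T G) : Prop :=
  ∃ f : X.carrier → Y.carrier, IsBlockMap X Y f ∧ Function.Bijective f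

/-- The points of `X`, to be preordered by inclusion of their sets of patterns. -/
def Points [TopologicalSpace S] (X : Subshift S G) : Type _ := X.carrier

/-- The subpattern preorder: `x ≤ y` if and only if `B(x) ⊆ B(y)`. -/
instance [Inhabited S] [TopologicalSpace S] (X : Subshift S G) : Preorder (Points X) :=
  Preorder.lift fun x : X.carrier => patternsOf x.1

/-- The subpattern poset `SP(X)`: the quotient of the points of `X`, preordered by `≤`, by the
equivalence `x ≤ y ∧ y ≤ x`, with the induced partial order. -/
abbrev SP [Inhabited S] [TopologicalSpace S] (X : Subshift S G) : Type _ :=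
  Antisymmetrization (Points X) (· ≤ ·)

end General

section Determinism

variable {S : Type*}

/-- The open upper half plane `H = {(a, b) | b ≥ 1}`. -/
def upperHalf : Set Z2 := {n | 1 ≤ n 1}

/-- Southward determinism: for every configuration `x` there is at most one `y` in `X` with
`x|_H = y|_H`. (A configuration `x` for which such a `y` exists contains no forbidden pattern
of `X` inside `H`, so it makes no difference to require this of `x` beforehand.) -/
def SouthwardDeterministic (X : Set (Z2 → S)) : Prop :=
  ∀ x : Z2 → S, {y ∈ X | ∀ n ∈ upperHalf, x n = y n}.Subsingleton

/-- The action of `A ∈ SL₂(ℤ)` on configurations: `A(x)_n = x_{A⁻¹ n}`. -/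
def transform (A : Matrix.SpecialLinearGroup (Fin 2) ℤ) (x : Z2 → S) : Z2 → S :=
  fun n => x ((A⁻¹).1.mulVec n)

/-- The counterclockwise rotation by `π / 2`. -/
def quarterTurn : Matrix (Fin 2) (Fin 2) ℤ := !![0, -1; 1, 0]

/-- A direction is a vector with coprime integer coordinates. -/
def IsDirection (d : Z2) : Prop := Int.gcd (d 0) (d 1) = 1

/-- `X` is deterministic in the direction `d` if `A(X)` is southward deterministic, where
`A ∈ SL₂(ℤ)` maps the counterclockwise rotation of `d` to `(1, 0)`. Any two such `A` differ by a
horizontal shear, which preserves `H`, so the choice of `A` does not matter. -/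
def DeterministicInDirection [TopologicalSpace S] (X : Subshift S Z2) (d : Z2) : Prop :=
  ∃ A : Matrix.SpecialLinearGroup (Fin 2) ℤ,
    A.1.mulVec (quarterTurn.mulVec d) = ![1, 0] ∧
      SouthwardDeterministic (transform A '' X.carrier)

/-- `X` is deterministic if it is deterministic in some direction. -/
def Deterministic [TopologicalSpace S] (X : Subshift S Z2) : Prop :=
  ∃ d : Z2, IsDirection d ∧ DeterministicInDirection X d

end Determinism

section PProperty

variable {S : Type*}

/-- The projective subdynamics of `X`: the set of the rows `x_0` of the points `x` of `X`
(by translation invariance, the set of all rows of all points). -/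
def projectiveSubdynamics [TopologicalSpace S] (X : Subshift S Z2) : Set (ℤ → S) :=
  (fun (x : Z2 → S) (j : ℤ) => x ![j, 0]) '' X.carrier

/-- The rows of `X` are all contained in a countable one-dimensional SFT. -/
def RowsInCountableSFT [Inhabited S] [TopologicalSpace S] (X : Subshift S Z2) : Prop :=
  ∃ Y : Subshift S ℤ, IsSFT Y ∧ Y.carrier.Countable ∧ projectiveSubdynamics X ⊆ Y.carrier

/-- The P property (in the default direction): some subshift conjugate to `X`, over a finite
alphabet, has all its rows in a countable one-dimensional SFT. -/
def HasPProperty [TopologicalSpace S] (X : Subshift S Z2) : Prop :=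
  ∃ (T : Type) (_ : Finite T) (_ : Inhabited T) (_ : TopologicalSpace T)
    (_ : DiscreteTopology T) (X' : Subshift T Z2), Conjugate X X' ∧ RowsInCountableSFT X'

end PProperty

end SFTPoset

/-!
The points that represent `P` are space-time diagrams of a reversible system of walls moving on
the half line `0, 1, 2, …`. The walls `0, …, k - 1` are at positions `d₀ ≤ d₁ ≤ ⋯`. Wall `0`
moves by one in each step and turns at the origin and at wall `1`; whenever it has reached wall
`1`, it also makes wall `1` move by one; whenever wall `1` has thus reached wall `2`, it makes wall
`2` move, and so on. Starting at the origin, the outermost wall moves away for ever, and each other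
wall `i` travels to and fro between the origin and wall `i + 1`. Reversing all directions conjugates
a step to its inverse (`State.step_flip_step`).

Every wall has a colour in `P`. The outermost wall has a fixed colour `p`, and if wall `i + 1` has
the colour `q` and is at `d`, then wall `i` has the colour `lab d` or `q`, according to whether
`lab d ≤ q`, where `lab` runs periodically through all elements of `P`. The colours are functions of
the positions (`colour`), hence do not interfere with the movement. A symbol of the diagram shows
the position modulo the period, the origin, and the walls at the place, with their directions and
colours. Since all walls that move in a step are together at one place, and each of them has its
new colour determined there, the next state of a cell depends only on its neighbours, in the same
way for all `k` and `p` (`cellAt_step_congr`).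

The subshift `diagramShift` consists of the configurations all of whose `3 × 3` windows occur in
such diagrams. It is of finite type by definition, and by the local rule each of its rows determines
the rows above and below it. In a row every wall occurs at most once, so the rows lie in the
countable subshift of finite type `rowShift`. So the subshift is deterministic and countable, and
it is itself a witness of the P property.

In the system of `k + 1` walls with the outermost colour `p`, the lower `k` walls return together to
the origin for every position `D` of the outermost wall (`State.sameCycle_init_put`). Around this
moment the diagram is, within distance `D`, that of the system of `k` walls with the colour selected
by `p` and `D` (`cellAt_evolve_put`), which is any given `q ≤ p` for suitable large `D`. Hence the
diagram of `(k, q)` is below that of `(k + 1, p)` if `q ≤ p`. Conversely, all colours in a diagram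
are at most the outermost one (`le_of_patternsOf_subset`). So `p` is represented by the diagram of
`(k, p)`, with a number `k` of walls that is strictly monotone in `p`: the number of elements
below `p`.
-/

namespace SFTPoset

open SymbolicDynamics.FullShift

/-! ### Subshifts of finite type defined by the windows of a set of configurations -/

section Hull

variable {S G : Type*} [Inhabited S] [AddMonoid G]

/-- The patterns with support `U` that occur in no configuration of `Z`. -/
def absentPatterns (U : Finset G) (Z : Set (G → S)) : Set (Pattern S G) :=
  {p | p.support = U ∧ ∀ z ∈ Z, ∀ h, ¬ p.occursInAt z h}

theorem mem_forbidden_absentPatterns {U : Finset G} {Z : Set (G → S)} {x : G → S} :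
    x ∈ forbidden (absentPatterns U Z) ↔
      ∀ g, ∃ z ∈ Z, ∃ h, ∀ u ∈ U, x (g + u) = z (h + u) := by
  classical
  constructor
  · intro hx g
    let p : Pattern S G :=
      { config := fun u => if u ∈ U then x (g + u) else default
        support := U
        condition := fun u hu => if_neg hu }
    have hp : p.occursInAt x g := fun u hu => (if_pos hu).symm
    by_contra! hcon
    refine hx p ⟨rfl, fun z hz h hocc => ?_⟩ g hp
    obtain ⟨u, hu, hne⟩ := hcon z hz h
    exact hne ((hp u hu).trans (hocc u hu).symm)
  · rintro hx p ⟨rfl, hp⟩ g hocc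
    obtain ⟨z, hz, h, hzh⟩ := hx g
    exact hp z hz h fun u hu => (hzh u hu).symm.trans (hocc u hu)

variable [TopologicalSpace S] [DiscreteTopology S] [IsLeftCancelAdd G]

/-- The subshift of all configurations whose windows of shape `U` all occur in configurations
of `Z`. -/
def windowHull (U : Finset G) (Z : Set (G → S)) : Subshift S G :=
  Subshift.ofForbidden (absentPatterns U Z)

theorem mem_windowHull {U : Finset G} {Z : Set (G → S)} {x : G → S} :
    x ∈ (windowHull U Z).carrier ↔ ∀ g, ∃ z ∈ Z, ∃ h, ∀ u ∈ U, x (g + u) = z (h + u) :=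
  mem_forbidden_absentPatterns

theorem subset_windowHull (U : Finset G) (Z : Set (G → S)) : Z ⊆ (windowHull U Z).carrier :=
  fun z hz => mem_windowHull.2 fun g => ⟨z, hz, g, fun _ _ => rfl⟩

theorem isSFT_windowHull [Finite S] (U : Finset G) (Z : Set (G → S)) :
    IsSFT (windowHull U Z) :=
  ⟨absentPatterns U Z,
    (finite_setOfPred_pattern_support_eq U).subset fun _ hp => hp.1, rfl⟩

end Hull

/-! ### Sequences with a single mark -/

section Mark

variable {D : Type*}

/-- The bi-infinite sequence that shows the datum `v` at the position `d`, and elsewhere only on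
which side of `d` it is being read: `inl true` to the left of `d`, `inl false` to the right. -/
def mark (d : ℤ) (v : D) (a : ℤ) : Bool ⊕ D :=
  if a < d then .inl true else if a = d then .inr v else .inl false

theorem mark_of_lt {d a : ℤ} (v : D) (h : a < d) : mark d v a = .inl true := if_pos h

theorem mark_self (d : ℤ) (v : D) : mark d v d = .inr v := by simp [mark]

theorem mark_of_gt {d a : ℤ} (v : D) (h : d < a) : mark d v a = .inl false := by
  simp [mark, h.not_gt, h.ne']

theorem mark_eq_mark_iff {d d' a a' : ℤ} {v v' : D} :
    mark d v a = mark d' v' a' ↔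
      (a < d ∧ a' < d') ∨ (a = d ∧ a' = d' ∧ v = v') ∨ (d < a ∧ d' < a') := by
  rcases lt_trichotomy a d with h | rfl | h <;> rcases lt_trichotomy a' d' with h' | rfl | h' <;>
    simp [mark_self, mark_of_lt, mark_of_gt, *, not_lt_of_gt, LT.lt.ne, LT.lt.ne']

theorem mark_eq_inl_true_iff {d a : ℤ} {v : D} : mark d v a = .inl true ↔ a < d := by
  rcases lt_trichotomy a d with h | rfl | h <;>
    simp [mark_self, mark_of_lt, mark_of_gt, *, not_lt_of_gt]

theorem mark_eq_inl_false_iff {d a : ℤ} {v : D} : mark d v a = .inl false ↔ d < a := by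
  rcases lt_trichotomy a d with h | rfl | h <;>
    simp [mark_self, mark_of_lt, mark_of_gt, *, not_lt_of_gt]

theorem mark_eq_inr_iff {d a : ℤ} {v w : D} : mark d v a = .inr w ↔ a = d ∧ v = w := by
  rcases lt_trichotomy a d with h | rfl | h <;>
    simp [mark_self, mark_of_lt, mark_of_gt, *, LT.lt.ne, LT.lt.ne']

/-- The pairs of symbols that may be adjacent in a sequence with at most one mark. -/
def MarkAdj (u v : Bool ⊕ D) : Prop :=
  (u = .inl true → v ≠ .inl false) ∧ (u ≠ .inl true → v = .inl false)

theorem markAdj_mark (d : ℤ) (v : D) (a : ℤ) : MarkAdj (mark d v a) (mark d v (a + 1)) := by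
  simp only [MarkAdj, ne_eq, mark_eq_inl_true_iff, mark_eq_inl_false_iff]
  omega

theorem markAdj_true : MarkAdj (.inl true : Bool ⊕ D) (.inl true) := by simp [MarkAdj]

/-- Besides the sequences `mark d v` only two constant sequences satisfy the adjacency rule. -/
theorem countable_setOf_markAdj [Countable D] :
    {z : ℤ → Bool ⊕ D | ∀ j, MarkAdj (z j) (z (j + 1))}.Countable := by
  refine (((Set.countable_range fun q : ℤ × D => mark q.1 q.2).insert fun _ => .inl true).insert
    fun _ => .inl false).mono ?_
  intro z hz
  have right : ∀ i j, i < j → z i ≠ .inl true → z j = .inl false := by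
    intro i j hij hi
    induction j, hij using Int.leInduction with
    | base => exact (hz i).2 hi
    | succ j _ ih => exact (hz j).2 (by simp [ih])
  by_cases hmark : ∃ i v, z i = .inr v
  · obtain ⟨i, v, hi⟩ := hmark
    refine Or.inr (Or.inr ⟨(i, v), funext fun j => ?_⟩)
    rcases lt_trichotomy j i with h | rfl | h
    · by_contra hne
      change ¬ mark i v j = z j at hne
      rw [mark_of_lt v h] at hne
      simpa [hi] using right j i h (Ne.symm hne)
    · rw [hi]; exact mark_self j v
    · rw [right i j h (by simp [hi])]; exact mark_of_gt v h
  push Not at hmark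
  have inl : ∀ j, z j = .inl true ∨ z j = .inl false := by
    intro j
    rcases h : z j with (_ | _) | v
    · exact Or.inr rfl
    · exact Or.inl rfl
    · exact absurd h (hmark j v)
  by_cases htrue : ∀ j, z j = .inl true
  · exact Or.inr (Or.inl (funext htrue))
  push Not at htrue
  obtain ⟨i, hi⟩ := htrue
  refine Or.inl (funext fun j => (inl j).resolve_left fun hj => ?_)
  have up : ∀ m, j ≤ m → z m = .inl true := by
    intro m hm
    induction m, hm using Int.leInduction with
    | base => exact hj
    | succ m _ ih => exact (inl _).resolve_right ((hz m).1 ih)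
  rcases le_or_gt j i with h | h
  · exact hi (up i h)
  · simpa [hj] using right i j h hi

end Mark

/-! ### The reversible dynamics of the walls -/

/-- A state of the wall system: the positions of the walls `0, 1, 2, …`, and for each of them
whether it is moving up, i.e. away from the origin. In a system of `k` walls only the
walls `i < k` matter. -/
@[ext]
structure State where
  /-- The distance of a wall from the origin. -/
  pos : ℕ → ℕ
  /-- Whether a wall is moving away from the origin. -/
  up : ℕ → Bool

namespace State

variable {k : ℕ} {s : State}

/-- The states that occur in a system of `k` walls: the walls are in their order. -/
def Sorted (k : ℕ) (s : State) : Prop := ∀ i, i + 1 < k → s.pos i ≤ s.pos (i + 1)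

/-- Reversal of all directions of motion. -/
def flip (s : State) : State := ⟨s.pos, fun i => !s.up i⟩

@[simp] theorem flip_flip (s : State) : s.flip.flip = s := by simp [flip]

theorem sorted_flip : s.flip.Sorted k ↔ s.Sorted k := Iff.rfl

/-- A wall is blocked if it wants to move up and the next wall is where wall `0` is. The notion is
used only for walls that are themselves at the place of wall `0`, and is thus visible there. -/
def Blocked (k : ℕ) (s : State) (i : ℕ) : Prop :=
  i + 1 < k ∧ s.up i = true ∧ s.pos (i + 1) = s.pos 0

theorem exists_not_blocked (k : ℕ) (s : State) : ∃ i, ¬ s.Blocked k i :=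
  ⟨k, fun h => by have := h.1; omega⟩

open scoped Classical in
/-- The least wall that is not blocked. It and all walls below it are at one place, and they are
the walls that move in the next step. -/
noncomputable def lead (k : ℕ) (s : State) : ℕ := Nat.find (exists_not_blocked k s)

theorem not_blocked_lead (k : ℕ) (s : State) : ¬ s.Blocked k (s.lead k) := by
  classical exact Nat.find_spec (exists_not_blocked k s)

theorem blocked_of_lt_lead {i : ℕ} (h : i < s.lead k) : s.Blocked k i := by
  classical exact not_not.1 (Nat.find_min (exists_not_blocked k s) h)

theorem lead_eq {L : ℕ} (h : ¬ s.Blocked k L) (h' : ∀ i < L, s.Blocked k i) : s.lead k = L := by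
  classical exact (Nat.find_eq_iff _).2 ⟨h, fun i hi => not_not.2 (h' i hi)⟩

theorem pos_eq_of_le_lead {i : ℕ} (h : i ≤ s.lead k) : s.pos i = s.pos 0 := by
  cases i with
  | zero => rfl
  | succ i => exact (blocked_of_lt_lead h).2.2

theorem lead_lt (hk : 0 < k) : s.lead k < k := by
  cases h : s.lead k with
  | zero => exact hk
  | succ L => exact (blocked_of_lt_lead (by omega : L < s.lead k)).1

/-- The place to which the leading wall takes the walls below it. At the origin the truncated
subtraction makes a wall that wants to move down stay where it is. -/
noncomputable def target (k : ℕ) (s : State) : ℕ :=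
  if s.up (s.lead k) then s.pos 0 + 1 else s.pos 0 - 1

/-- One step: the leading wall moves by one and takes along the walls below it, which turn from
moving up to moving down; a leading wall that wants to move down at the origin instead turns. -/
noncomputable def step (k : ℕ) (s : State) : State where
  pos i := if i ≤ s.lead k then s.target k else s.pos i
  up i := if i < s.lead k then false
    else if i = s.lead k then s.up i || decide (s.pos 0 = 0) else s.up i

theorem Sorted.step (h : s.Sorted k) : (s.step k).Sorted k := by
  intro i hi
  have hL := not_blocked_lead k s
  have hs := h i hi
  have h0 : i ≤ s.lead k → s.pos i = s.pos 0 := pos_eq_of_le_lead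
  simp only [State.step, target]
  simp only [Blocked, not_and] at hL
  rcases lt_trichotomy i (s.lead k) with h1 | h1 | h1
  · simp [h1.le, Nat.succ_le_of_lt h1]
  · have := hL (by omega)
    subst h1
    specialize h0 le_rfl
    simp only [le_refl, if_true, show ¬ s.lead k + 1 ≤ s.lead k by omega, if_false]
    split_ifs with h2
    · have := this h2
      omega
    · omega
  · simp [show ¬ i ≤ s.lead k by omega, show ¬ i + 1 ≤ s.lead k by omega, hs]

/-- After the reversal of all directions the same walls move back. -/
theorem lead_flip_step (h : s.Sorted k) : (s.step k).flip.lead k = s.lead k := by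
  apply lead_eq
  · rintro ⟨h1, h2, h3⟩
    have hs := h _ h1
    rw [pos_eq_of_le_lead le_rfl] at hs
    simp only [flip, step, lt_irrefl, if_false, if_true, Bool.not_eq_true', Bool.or_eq_false_iff,
      decide_eq_false_iff_not] at h2
    simp only [flip, step, show ¬ s.lead k + 1 ≤ s.lead k by omega, if_false, zero_le, if_true,
      target, h2.1, Bool.false_eq_true] at h3
    omega
  · intro i hi
    have hb := blocked_of_lt_lead hi
    refine ⟨hb.1, by simp [flip, step, hi], by simp [flip, step, Nat.succ_le_of_lt hi]⟩

/-- Reversal of all directions conjugates a step to its inverse. -/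
theorem step_flip_step (h : s.Sorted k) : (s.step k).flip.step k = s.flip := by
  have hL := lead_flip_step h
  have hup : (s.step k).flip.up (s.lead k) = !(s.up (s.lead k) || decide (s.pos 0 = 0)) := by
    simp [flip, step]
  have h0 : (s.step k).flip.pos 0 = s.target k := by simp [flip, step]
  have ht : (s.step k).flip.target k = s.pos 0 := by
    rw [target, hL, hup, h0, target]
    cases s.up (s.lead k) <;> by_cases hz : s.pos 0 = 0 <;> simp [hz]
    omega
  ext i
  · rw [step, hL, ht]
    by_cases hi : i ≤ s.lead k
    · simp [hi, flip, pos_eq_of_le_lead hi]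
    · simp [hi, flip, step]
  · rw [step, hL, h0]
    rcases lt_trichotomy i (s.lead k) with hi | rfl | hi
    · simp [hi, flip, (blocked_of_lt_lead hi).2.1]
    · simp only [lt_irrefl, if_false, if_true]
      rw [hup, target]
      change _ = !s.up (s.lead k)
      cases s.up (s.lead k) <;> by_cases hz : s.pos 0 = 0 <;> simp [hz]
    · simp [flip, step, hi.not_gt, hi.ne']

open scoped Classical in
/-- A step in a system of `k` walls as a permutation of all states; states in which the walls are
not in order are fixed. -/
noncomputable def evolve (k : ℕ) : Equiv.Perm State where
  toFun s := if s.Sorted k then s.step k else s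
  invFun s := if s.Sorted k then (s.flip.step k).flip else s
  left_inv s := by
    by_cases h : s.Sorted k
    · simp [h, h.step, step_flip_step h]
    · simp [h]
  right_inv s := by
    by_cases h : s.Sorted k
    · have h' : (s.flip.step k).flip.Sorted k := Sorted.step (s := s.flip) h
      simp [h, h', step_flip_step (s := s.flip) h]
    · simp [h]

theorem evolve_apply (h : s.Sorted k) : evolve k s = s.step k := by simp [evolve, h]

theorem evolve_inv_apply (h : s.Sorted k) : (evolve k)⁻¹ s = (s.flip.step k).flip := by
  change (evolve k).symm s = _
  simp [evolve, h]

theorem Sorted.evolve_zpow (h : s.Sorted k) (t : ℤ) : ((evolve k ^ t) s).Sorted k := by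
  induction t using Int.induction_on with
  | zero => exact h
  | succ t ih =>
    rw [add_comm, zpow_add, zpow_one, Equiv.Perm.mul_apply, evolve_apply ih]
    exact ih.step
  | pred t ih =>
    rw [sub_eq_neg_add, zpow_add, zpow_neg_one, Equiv.Perm.mul_apply, evolve_inv_apply ih]
    exact Sorted.step (s := flip _) ih

theorem evolve_inv_apply_eq (s : State) : (evolve k)⁻¹ s = (evolve k s.flip).flip := by
  by_cases h : s.Sorted k
  · rw [evolve_inv_apply h, evolve_apply (sorted_flip.2 h)]
  · change (evolve k).symm s = _
    simp [evolve, h, sorted_flip]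

theorem sameCycle_flip {s s' : State} (h : (evolve k).SameCycle s s') :
    (evolve k).SameCycle s.flip s'.flip := by
  let τ : Equiv.Perm State := ⟨flip, flip, flip_flip, flip_flip⟩
  have hτ : τ * evolve k * τ⁻¹ = (evolve k)⁻¹ := by
    ext1 s
    exact (evolve_inv_apply_eq s).symm
  have := h.conj (g := τ)
  rwa [hτ, Equiv.Perm.sameCycle_inv] at this

/-! ### Recurrence -/

/-- The state `s` with wall `j` put to the place `D`, in the direction `b`. -/
def put (j D : ℕ) (b : Bool) (s : State) : State :=
  ⟨Function.update s.pos j D, Function.update s.up j b⟩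

/-- The state `s` with all walls below `j` put to the place `D`, in the direction `b`. -/
def block (j D : ℕ) (b : Bool) (s : State) : State :=
  ⟨fun i => if i < j then D else s.pos i, fun i => if i < j then b else s.up i⟩

theorem block_zero (D : ℕ) (b : Bool) (s : State) : s.block 0 D b = s := by simp [block]

theorem block_put (j D : ℕ) (b : Bool) (s : State) :
    (s.put j D b).block j D b = s.block (j + 1) D b := by
  ext i <;> simp only [block, put, Function.update_apply] <;> split_ifs <;> first | rfl | omega

theorem flip_block (j D : ℕ) (b : Bool) (s : State) :
    (s.block j D b).flip = s.flip.block j D (!b) := by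
  ext i <;> simp only [block, flip]
  split_ifs <;> rfl

/-- When the walls up to `j` are together at `D` and all of them move up, wall `j` is pushed to
`D + 1` and the walls below it turn. -/
theorem step_block {j D : ℕ} (hj : j < k) (hD : j + 1 < k → D < s.pos (j + 1)) :
    (s.block (j + 1) D true).step k = (s.put j (D + 1) true).block j (D + 1) false := by
  have hL : (s.block (j + 1) D true).lead k = j := by
    apply lead_eq
    · rintro ⟨h1, -, h3⟩
      have := hD h1
      simp [block] at h3
      omega
    · intro i hi
      refine ⟨by omega, by simp [block]; omega, by simp [block]; omega⟩
  have ht : (s.block (j + 1) D true).target k = D + 1 := by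
    rw [target, hL]
    simp [block]
  ext i
  · simp only [step, hL, ht]
    simp only [block, put, Function.update_apply]
    split_ifs <;> first | rfl | omega
  · simp only [step, hL]
    simp only [block, put, Function.update_apply]
    split_ifs <;> first | rfl | omega

/-- At the origin, a wall `j` that moves down turns when the walls below it push it. -/
theorem step_put_block_zero {j : ℕ} (hj : j < k) :
    ((s.put j 0 false).block j 0 true).step k = (s.put j 0 true).block j 0 false := by
  have hL : ((s.put j 0 false).block j 0 true).lead k = j := by
    apply lead_eq
    · rintro ⟨-, h2, -⟩
      simp [block, put] at h2
    · intro i hi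
      refine ⟨by omega, by simp [block, hi], ?_⟩
      simp only [block, put, Function.update_apply]
      split_ifs <;> first | rfl | omega
  have h0 : ((s.put j 0 false).block j 0 true).pos 0 = 0 := by
    simp only [block, put, Function.update_apply]
    split_ifs <;> first | rfl | omega
  have ht : ((s.put j 0 false).block j 0 true).target k = 0 := by
    rw [target, hL, h0]
    simp [block, put]
  ext i
  · simp only [step, hL, ht]
    simp only [block, put, Function.update_apply]
    split_ifs <;> first | rfl | omega
  · simp only [step, hL, h0]
    simp only [block, put, Function.update_apply]
    split_ifs <;> rfl

/-- The walls from `j` on are in order. This is what the movement of the walls below `j` requires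
of the others. -/
def SortedFrom (k j : ℕ) (s : State) : Prop := ∀ i, j ≤ i → i + 1 < k → s.pos i ≤ s.pos (i + 1)

theorem SortedFrom.block {j D : ℕ} {b : Bool} (h : s.SortedFrom k j)
    (hD : j < k → D ≤ s.pos j) : (s.block j D b).Sorted k := by
  intro i hi
  simp only [State.block]
  split_ifs with h1 h2 h2
  · exact le_rfl
  · obtain rfl : j = i + 1 := by omega
    exact hD hi
  · omega
  · exact h i (by omega) hi

theorem SortedFrom.put {j D : ℕ} {b : Bool} (h : s.SortedFrom k (j + 1))
    (hD : j + 1 < k → D ≤ s.pos (j + 1)) : (s.put j D b).SortedFrom k j := by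
  intro i hji hi
  simp only [State.put, Function.update_apply]
  split_ifs with h1 h2 h2
  · omega
  · subst h1; exact hD hi
  · omega
  · exact h i (by omega) hi

/-- Walls that are together at the origin and move down all turn, one after the other, in the
manner of a binary counter. -/
theorem sameCycle_block_zero {j : ℕ} (hj : j ≤ k) : ∀ {s : State}, s.SortedFrom k j →
    (evolve k).SameCycle (s.block j 0 false) (s.block j 0 true) := by
  induction j with
  | zero => intro s _; simp only [block_zero]; exact .refl _ _
  | succ j ih =>
    intro s hs
    have h1 : ∀ b, (s.put j 0 b).SortedFrom k j := fun b => hs.put fun _ => Nat.zero_le _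
    have key := step_put_block_zero (s := s) (show j < k by omega)
    rw [← evolve_apply ((h1 false).block fun _ => Nat.zero_le _)] at key
    rw [← block_put, ← block_put]
    refine (ih (by omega) (h1 false)).trans
      (Equiv.Perm.SameCycle.trans ?_ (ih (by omega) (h1 true)))
    rw [← key, Equiv.Perm.sameCycle_apply_right]

/-- Given that the walls below `j` can travel freely between the origin and wall `j` (`ih`), wall
`j` moves up by one, and the walls below it return to the origin. -/
theorem sameCycle_put_succ {j D : ℕ} (hj : j < k) {s : State} (hs : s.SortedFrom k (j + 1))
    (hD : j + 1 < k → D < s.pos (j + 1))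
    (ih : ∀ {D : ℕ} {s : State}, s.SortedFrom k j → (j < k → D ≤ s.pos j) →
      (evolve k).SameCycle (s.block j 0 true) (s.block j D true)) :
    (evolve k).SameCycle (s.block (j + 1) D true) ((s.put j (D + 1) true).block j 0 false) := by
  have h1 : (s.put j (D + 1) true).SortedFrom k j := hs.put fun h => hD h
  have key := step_block hj hD
  rw [← evolve_apply (hs.block fun h => (hD h).le)] at key
  rw [← Equiv.Perm.sameCycle_apply_left, key]
  -- The walls below `j` return to the origin on the reversed path of an outward journey.
  have h2 := sameCycle_flip (ih (D := D + 1) (s := (s.put j (D + 1) true).flip) h1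
    fun _ => by simp [flip, put])
  rw [flip_block, flip_block, flip_flip] at h2
  exact h2.symm

/-- The walls below `j` travel from the origin, all of them moving up, to any place not above
wall `j`. -/
theorem sameCycle_block {j : ℕ} (hj : j ≤ k) : ∀ {D : ℕ} {s : State}, s.SortedFrom k j →
    (j < k → D ≤ s.pos j) →
    (evolve k).SameCycle (s.block j 0 true) (s.block j D true) := by
  induction j with
  | zero => intro D s _ _; simp only [block_zero]; exact .refl _ _
  | succ j ih =>
    intro D s hs hD
    induction D with
    | zero => exact .refl _ _
    | succ D ihD =>
      have h1 : (s.put j (D + 1) true).SortedFrom k j := hs.put fun h => hD h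
      refine (ihD fun h => (Nat.le_succ D).trans (hD h)).trans ?_
      refine (sameCycle_put_succ (by omega) hs (fun h => hD h) (ih (by omega))).trans ?_
      refine (sameCycle_block_zero (by omega) h1).trans ?_
      rw [← block_put]
      exact ih (by omega) h1 fun _ => by simp [put]

/-- The initial state: all walls at the origin, moving down. -/
def init : State := ⟨fun _ => 0, fun _ => false⟩

theorem sorted_init (k : ℕ) : init.Sorted k := fun _ _ => le_rfl

/-- In a system of `k + 1` walls the initial state of the lower `k` walls recurs with the
outermost wall at every positive distance. -/
theorem sameCycle_init_put {D : ℕ} (hD : 0 < D) :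
    (evolve (k + 1)).SameCycle init (init.put k D true) := by
  obtain ⟨D, rfl⟩ := Nat.exists_eq_succ_of_ne_zero hD.ne'
  have h : init.SortedFrom (k + 1) (k + 1) := fun _ _ _ => le_rfl
  have h0 : init.block (k + 1) 0 false = init := by ext i <;> simp [block, init]
  have h1 : (init.put k (D + 1) true).block k 0 false = init.put k (D + 1) true := by
    ext i <;> simp only [block, put, init, Function.update_apply] <;> split_ifs <;>
      first | rfl | omega
  have := (sameCycle_block_zero le_rfl h).trans <|
    (sameCycle_block le_rfl (D := D) h fun h => absurd h (lt_irrefl _)).trans <|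
    sameCycle_put_succ (Nat.lt_succ_self k) h (fun h => absurd h (lt_irrefl _))
      (sameCycle_block (Nat.le_succ k))
  rwa [h0, h1] at this

end State

/-! ### Colours, cells and the local rule -/

section Cells

variable {P : Type*} {N : ℕ}

/-- The symbols of the space-time diagrams: the position modulo `N`, the side of the origin, and
for each of `n` walls the side of the wall or, at the wall itself, its direction and its colour. -/
@[ext]
structure Cell (P : Type*) (N n : ℕ) where
  /-- The position modulo `N`. -/
  phase : ZMod N
  /-- The side of the origin. -/
  origin : Bool ⊕ Unit
  /-- The side of each wall, or its direction and its colour. -/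
  walls : Fin n → Bool ⊕ (Bool × P)

instance [Finite P] [NeZero N] (n : ℕ) : Finite (Cell P N n) :=
  Finite.of_injective (fun c : Cell P N n => (c.phase, c.origin, c.walls)) fun c c' h => by
    simp only [Prod.mk.injEq] at h
    exact Cell.ext h.1 h.2.1 h.2.2

instance (n : ℕ) : Inhabited (Cell P N n) := ⟨⟨0, .inl true, fun _ => .inl true⟩⟩

instance (n : ℕ) : TopologicalSpace (Cell P N n) := ⊥

instance (n : ℕ) : DiscreteTopology (Cell P N n) := ⟨rfl⟩

/-- Reversal of the directions of the walls in a cell. -/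
def Cell.flip {n : ℕ} (c : Cell P N n) : Cell P N n :=
  ⟨c.phase, c.origin, fun i => (c.walls i).map id (Prod.map not id)⟩

variable [PartialOrder P] (lab : ZMod N → P)

open scoped Classical in
/-- The colour `lab r` if it is at most `p`, and `p` otherwise: a choice of a colour below `p`. -/
noncomputable def sel (p : P) (r : ZMod N) : P := if lab r ≤ p then lab r else p

theorem sel_le (p : P) (r : ZMod N) : sel lab p r ≤ p := by
  unfold sel
  split_ifs with h
  exacts [h, le_rfl]

theorem sel_eq {p : P} {r : ZMod N} (h : lab r ≤ p) : sel lab p r = lab r := if_pos h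

/-- The colour of the `m`-th wall, counted from the outermost one of `k` walls. -/
noncomputable def colourFromTop (k : ℕ) (p : P) (d : ℕ → ℕ) : ℕ → P
  | 0 => p
  | m + 1 => sel lab (colourFromTop k p d m) (d (k - 1 - m))

/-- The colour of wall `i` in a system of `k` walls at the positions `d`. The outermost wall has
the colour `p`, and every other wall has the colour that is selected by the colour of the next
wall and its position. -/
noncomputable def colour (k : ℕ) (p : P) (d : ℕ → ℕ) (i : ℕ) : P :=
  colourFromTop lab k p d (k - 1 - i)

variable {lab} {k k' n : ℕ} {p p' : P}

theorem colour_last {d : ℕ → ℕ} {i : ℕ} (h : k ≤ i + 1) : colour lab k p d i = p := by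
  rw [colour, show k - 1 - i = 0 by omega, colourFromTop]

theorem colour_of_lt {d : ℕ → ℕ} {i : ℕ} (h : i + 1 < k) :
    colour lab k p d i = sel lab (colour lab k p d (i + 1)) (d (i + 1)) := by
  rw [colour, show k - 1 - i = (k - 1 - (i + 1)) + 1 by omega, colourFromTop, ← colour,
    show k - 1 - (k - 1 - (i + 1)) = i + 1 by omega]

/-- Two systems of walls have the same colours at the walls below `L` if they have the same colour
at `L` and the same positions, modulo `N`, up to `L`. -/
theorem colour_congr {d d' : ℕ → ℕ} {L : ℕ} (hk : L < k) (hk' : L < k')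
    (hL : colour lab k p d L = colour lab k' p' d' L)
    (hd : ∀ i ≤ L, (d i : ZMod N) = d' i) {i : ℕ} (hi : i ≤ L) :
    colour lab k p d i = colour lab k' p' d' i := by
  induction hi using Nat.decreasingInduction with
  | self => exact hL
  | of_succ i hi ih =>
    rw [colour_of_lt (show i + 1 < k by omega), colour_of_lt (show i + 1 < k' by omega), ih,
      hd _ hi]

theorem colour_congr_above {d d' : ℕ → ℕ} {i : ℕ} (hd : ∀ j, i < j → d j = d' j) :
    colour lab k p d i = colour lab k p d' i := by
  by_cases hik : i < k
  · have key : ∀ m, m ≤ k - 1 - i →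
        colourFromTop lab k p d m = colourFromTop lab k p d' m := by
      intro m hm
      induction m with
      | zero => rfl
      | succ m ih => rw [colourFromTop, colourFromTop, ih (by omega), hd _ (by omega)]
    exact key _ le_rfl
  · rw [colour_last (by omega), colour_last (by omega)]

theorem colour_le (k : ℕ) (p : P) (d : ℕ → ℕ) (i : ℕ) : colour lab k p d i ≤ p := by
  unfold colour
  induction k - 1 - i with
  | zero => exact le_rfl
  | succ m ih => exact (sel_le lab _ _).trans ih

variable (lab)

/-- What the cell at `a` shows of wall `i`; absent walls are to the right of everything. -/
noncomputable def wallAt (k : ℕ) (p : P) (s : State) (i : ℕ) (a : ℤ) : Bool ⊕ (Bool × P) :=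
  if i < k then mark (s.pos i) (s.up i, colour lab k p s.pos i) a else .inl true

/-- The cell at `a` of a state of a system of `k` walls with the outermost colour `p`. -/
noncomputable def cellAt (n k : ℕ) (p : P) (s : State) (a : ℤ) : Cell P N n :=
  ⟨a, mark 0 () a, fun i => wallAt lab k p s i a⟩

variable {lab} {s s' : State} {a a' : ℤ}

theorem wallAt_eq_inr_iff {i : ℕ} {w : Bool × P} :
    wallAt lab k p s i a = .inr w ↔
      i < k ∧ a = s.pos i ∧ (s.up i, colour lab k p s.pos i) = w := by
  unfold wallAt
  split_ifs with h <;> simp [h, mark_eq_inr_iff]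

theorem cellAt_flip : cellAt lab n k p s.flip a = (cellAt lab n k p s a).flip := by
  ext1
  · rfl
  · rfl
  · funext i
    simp only [cellAt, Cell.flip, wallAt, State.flip]
    by_cases hi : i < k
    · rcases lt_trichotomy a (s.pos i) with h | h | h
      · simp [hi, mark_of_lt, h]
      · simp [hi, h, mark_self]
      · simp [hi, mark_of_gt, h]
    · simp [hi]

theorem wallAt_eq_of_cellAt_eq (hkn : k ≤ n) (hkn' : k' ≤ n)
    (h : cellAt lab n k p s a = cellAt lab n k' p' s' a') (i : ℕ) :
    wallAt lab k p s i a = wallAt lab k' p' s' i a' := by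
  by_cases hi : i < n
  · exact congrFun (congrArg Cell.walls h) ⟨i, hi⟩
  · simp [wallAt, show ¬ i < k by omega, show ¬ i < k' by omega]

/-- Cells that look alike show the same walls. -/
theorem eq_of_wallAt_eq {i : ℕ} (h : wallAt lab k p s i a = wallAt lab k' p' s' i a')
    (hi : i < k) (ha : a = s.pos i) :
    i < k' ∧ a' = s'.pos i ∧ s'.up i = s.up i ∧
      colour lab k' p' s'.pos i = colour lab k p s.pos i := by
  have h1 := (wallAt_eq_inr_iff (lab := lab) (p := p)).2 ⟨hi, ha, rfl⟩
  rw [h] at h1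
  obtain ⟨h2, h3, h4⟩ := wallAt_eq_inr_iff.1 h1
  exact ⟨h2, h3, (Prod.ext_iff.1 h4).1, (Prod.ext_iff.1 h4).2⟩

theorem wallAt_step_of_lead_lt {i : ℕ} (h : s.lead k < i) :
    wallAt lab k p (s.step k) i a = wallAt lab k p s i a := by
  have hc : colour lab k p (s.step k).pos i = colour lab k p s.pos i :=
    colour_congr_above fun j hj => by simp [State.step, show ¬ j ≤ s.lead k by omega]
  rw [wallAt, wallAt, hc]
  simp [State.step, h.not_ge, h.not_gt, h.ne']

theorem target_bounds (s : State) : s.target k ≤ s.pos 0 + 1 ∧ s.pos 0 ≤ s.target k + 1 := by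
  unfold State.target
  split_ifs <;> omega

/-- Away from wall `0` a step changes nothing. -/
theorem wallAt_step_of_far {i : ℕ} (h : a + 1 < s.pos 0 ∨ (s.pos 0 : ℤ) < a - 1) :
    wallAt lab k p (s.step k) i a = wallAt lab k p s i a := by
  rcases le_or_gt i (s.lead k) with hi | hi
  · have h1 := State.pos_eq_of_le_lead hi
    have h2 := target_bounds (k := k) s
    have h3 : (s.step k).pos i = s.target k := by simp [State.step, hi]
    unfold wallAt
    rw [h3, h1]
    split_ifs with hik
    · rw [mark_eq_mark_iff]
      omega
    · rfl
  · exact wallAt_step_of_lead_lt hi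

/-- The leading wall is visible in the cell of wall `0`. -/
theorem lead_eq_of_wallAt_eq (hk : 0 < k)
    (h : ∀ i, wallAt lab k p s i (s.pos 0) = wallAt lab k' p' s' i (s'.pos 0)) :
    s'.lead k' = s.lead k := by
  apply State.lead_eq
  · rintro ⟨h1, h2, h3⟩
    have h4 := eq_of_wallAt_eq (h (s.lead k)) (State.lead_lt hk)
      (by rw [State.pos_eq_of_le_lead le_rfl])
    have h5 := eq_of_wallAt_eq (h (s.lead k + 1)).symm h1 (by rw [h3])
    refine State.not_blocked_lead k s ⟨h5.1, ?_, by exact_mod_cast h5.2.1.symm⟩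
    rw [← h4.2.2.1, h2]
  · intro i hi
    have hb := State.blocked_of_lt_lead hi
    have h4 := eq_of_wallAt_eq (h i) (by have := hb.1; omega)
      (by rw [State.pos_eq_of_le_lead hi.le])
    have h5 := eq_of_wallAt_eq (h (i + 1)) hb.1 (by rw [hb.2.2])
    exact ⟨h5.1, by rw [h4.2.2.1, hb.2.1], by exact_mod_cast h5.2.1.symm⟩

/-- The local rule: after a step, a cell depends only on itself and its two neighbours before. -/
theorem cellAt_step_congr (hk : 0 < k) (hk' : 0 < k') (hkn : k ≤ n) (hkn' : k' ≤ n)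
    (h : ∀ e : ℤ, -1 ≤ e → e ≤ 1 →
      cellAt lab n k p s (a + e) = cellAt lab n k' p' s' (a' + e)) :
    cellAt lab n k p (s.step k) a = cellAt lab n k' p' (s'.step k') a' := by
  have hw : ∀ e : ℤ, -1 ≤ e → e ≤ 1 → ∀ i,
      wallAt lab k p s i (a + e) = wallAt lab k' p' s' i (a' + e) :=
    fun e he he' => wallAt_eq_of_cellAt_eq hkn hkn' (h e he he')
  have h0 := h 0 (by norm_num) (by norm_num)
  have hw0 := hw 0 (by norm_num) (by norm_num)
  simp only [add_zero] at h0 hw0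
  have hphase : (a : ZMod N) = a' := congrArg Cell.phase h0
  ext1
  · exact hphase
  · exact (congrArg Cell.origin h0 : mark 0 () a = mark 0 () a')
  funext i
  change wallAt lab k p (s.step k) i a = wallAt lab k' p' (s'.step k') i a'
  -- Wall `0` is on the same side of both cells, and at the same distance if that is at most `1`.
  have hside := hw0 0
  simp only [wallAt, hk, hk', if_true, mark_eq_mark_iff] at hside
  by_cases hfar : a + 1 < s.pos 0 ∨ (s.pos 0 : ℤ) < a - 1
  · have hfar' : a' + 1 < s'.pos 0 ∨ (s'.pos 0 : ℤ) < a' - 1 := by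
      by_contra hnear
      have := eq_of_wallAt_eq (hw (s'.pos 0 - a') (by omega) (by omega) 0).symm hk' (by omega)
      omega
    rw [wallAt_step_of_far hfar, wallAt_step_of_far hfar', hw0]
  obtain ⟨e, he⟩ : ∃ e, a + e = s.pos 0 := ⟨s.pos 0 - a, by ring⟩
  have he1 : -1 ≤ e := by omega
  have he2 : e ≤ 1 := by omega
  have hwe := hw e he1 he2
  have he' : a' + e = s'.pos 0 := (eq_of_wallAt_eq (hwe 0) hk he).2.1
  have horigin : mark 0 () (a + e) = mark 0 () (a' + e) := congrArg Cell.origin (h e he1 he2)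
  simp only [he, he', mark_eq_mark_iff] at horigin hwe
  have hlead := lead_eq_of_wallAt_eq hk hwe
  have hLk := State.lead_lt (s := s) hk
  have hLk' := State.lead_lt (s := s') hk'
  obtain ⟨-, -, hup, hcol⟩ := eq_of_wallAt_eq (hwe (s.lead k)) hLk
    (by rw [State.pos_eq_of_le_lead le_rfl])
  have hzero : s.pos 0 = 0 ↔ s'.pos 0 = 0 := by omega
  have htarget : (s.target k : ℤ) - a = s'.target k' - a' := by
    unfold State.target
    rw [hlead, hup]
    split_ifs <;> omega
  rcases lt_or_ge (s.lead k) i with hi | hi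
  · rw [wallAt_step_of_lead_lt hi, wallAt_step_of_lead_lt (hlead ▸ hi), hw0]
  have hpos : ∀ j ≤ s.lead k, (s.step k).pos j = s.target k := fun j hj => by
    simp [State.step, hj]
  have hpos' : ∀ j ≤ s.lead k, (s'.step k').pos j = s'.target k' := fun j hj => by
    simp [State.step, hlead, hj]
  have hupi : (s.step k).up i = (s'.step k').up i := by
    simp only [State.step, hlead, hzero]
    split_ifs with h1 h2
    · rfl
    · rw [h2, hup]
    · omega
  have hcoli : colour lab k p (s.step k).pos i = colour lab k' p' (s'.step k').pos i := by
    refine colour_congr hLk (hlead ▸ hLk') ?_ (fun j hj => ?_) hi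
    · rw [colour_congr_above (d := (s.step k).pos) (d' := s.pos) fun j hj => ?_,
        colour_congr_above (d := (s'.step k').pos) (d' := s'.pos) fun j hj => ?_, hcol]
      · simp [State.step, hlead, hj.not_ge]
      · simp [State.step, hj.not_ge]
    · rw [hpos j hj, hpos' j hj]
      have h1 : ((s.target k : ℤ) : ZMod N) = ((s'.target k' : ℤ) : ZMod N) := by
        rw [show (s.target k : ℤ) = s'.target k' - a' + a by omega]
        push_cast
        rw [hphase]
        ring
      exact_mod_cast h1
  simp only [wallAt, show i < k by omega, show i < k' by omega, if_true, hpos i hi, hpos' i hi]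
  rw [hupi, hcoli, mark_eq_mark_iff]
  simp only [and_true]
  omega

theorem cellAt_evolve_congr (hk : 0 < k) (hk' : 0 < k') (hkn : k ≤ n) (hkn' : k' ≤ n)
    (hs : s.Sorted k) (hs' : s'.Sorted k')
    (h : ∀ e : ℤ, -1 ≤ e → e ≤ 1 →
      cellAt lab n k p s (a + e) = cellAt lab n k' p' s' (a' + e)) :
    cellAt lab n k p (State.evolve k s) a = cellAt lab n k' p' (State.evolve k' s') a' := by
  rw [State.evolve_apply hs, State.evolve_apply hs']
  exact cellAt_step_congr hk hk' hkn hkn' h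

/-- The local rule of the inverse dynamics, by reversal of all directions. -/
theorem cellAt_evolve_inv_congr (hk : 0 < k) (hk' : 0 < k') (hkn : k ≤ n) (hkn' : k' ≤ n)
    (hs : s.Sorted k) (hs' : s'.Sorted k')
    (h : ∀ e : ℤ, -1 ≤ e → e ≤ 1 →
      cellAt lab n k p s (a + e) = cellAt lab n k' p' s' (a' + e)) :
    cellAt lab n k p ((State.evolve k)⁻¹ s) a =
      cellAt lab n k' p' ((State.evolve k')⁻¹ s') a' := by
  rw [State.evolve_inv_apply hs, State.evolve_inv_apply hs', cellAt_flip, cellAt_flip,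
    cellAt_step_congr hk hk' hkn hkn' fun e he he' => ?_]
  rw [cellAt_flip, cellAt_flip, h e he he']

end Cells

/-! ### The space-time diagrams and their subshift -/

section Diagrams

variable {P : Type*} [PartialOrder P] {N : ℕ} (lab : ZMod N → P) (n : ℕ)

/-- The space-time diagram of the system of `k` walls with the outermost colour `p`: row `t` shows
the state at time `t`, and at time `0` all walls are at the origin. -/
noncomputable def diagram (k : ℕ) (p : P) : Z2 → Cell P N n :=
  fun v => cellAt lab n k p ((State.evolve k ^ v 1) State.init) (v 0)

/-- The space-time diagrams of the systems of at most `n` walls. -/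
def diagrams : Set (Z2 → Cell P N n) :=
  {x | ∃ k p, 0 < k ∧ k ≤ n ∧ x = diagram lab n k p}

/-- The `3 × 3` square around the origin. -/
noncomputable def box : Finset Z2 := Fintype.piFinset fun _ => Finset.Icc (-1) 1

theorem mem_box {u : Z2} : u ∈ box ↔ ∀ i, -1 ≤ u i ∧ u i ≤ 1 := by
  simp [box, Fintype.mem_piFinset]

/-- The configurations whose `3 × 3` windows all occur in space-time diagrams. -/
noncomputable def diagramShift : Subshift (Cell P N n) Z2 := windowHull box (diagrams lab n)

/-- The sequences whose windows of length two all occur in rows of space-time diagrams. -/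
noncomputable def rowShift : Subshift (Cell P N n) ℤ :=
  windowHull (Finset.Icc 0 1) {y | ∃ x ∈ diagrams lab n, ∃ b, y = fun j => x ![j, b]}

variable {lab n}

theorem vec_eta (v : Z2) : ![v 0, v 1] = v := by
  ext i; fin_cases i <;> rfl

/-- In space-time diagrams three adjacent symbols determine the ones above and below them. -/
theorem diagrams_vertical {x y : Z2 → Cell P N n} (hx : x ∈ diagrams lab n)
    (hy : y ∈ diagrams lab n) {g h : Z2}
    (hgh : ∀ e : ℤ, -1 ≤ e → e ≤ 1 → x (g + ![e, 0]) = y (h + ![e, 0])) :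
    x (g + ![0, -1]) = y (h + ![0, -1]) ∧ x (g + ![0, 1]) = y (h + ![0, 1]) := by
  obtain ⟨k, p, hk, hkn, rfl⟩ := hx
  obtain ⟨k', p', hk', hkn', rfl⟩ := hy
  have hs := (State.sorted_init k).evolve_zpow (g 1)
  have hs' := (State.sorted_init k').evolve_zpow (h 1)
  simp only [diagram, Pi.add_apply, Matrix.cons_val_zero, Matrix.cons_val_one, add_zero,
    add_comm (g 1), add_comm (h 1), zpow_add, zpow_one, zpow_neg, Equiv.Perm.mul_apply] at hgh ⊢
  exact ⟨cellAt_evolve_inv_congr hk hk' hkn hkn' hs hs' hgh,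
    cellAt_evolve_congr hk hk' hkn hkn' hs hs' hgh⟩

/-- A row of a point of the subshift determines the rows next to it. -/
theorem diagramShift_adjacent_rows {x y : Z2 → Cell P N n}
    (hx : x ∈ (diagramShift lab n).carrier) (hy : y ∈ (diagramShift lab n).carrier) {b : ℤ}
    (h : ∀ a, x ![a, b] = y ![a, b]) (a : ℤ) :
    x ![a, b - 1] = y ![a, b - 1] ∧ x ![a, b + 1] = y ![a, b + 1] := by
  obtain ⟨z, hz, g, hxz⟩ := mem_windowHull.1 hx ![a, b]
  obtain ⟨w, hw, g', hyw⟩ := mem_windowHull.1 hy ![a, b]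
  have hadd : ∀ e f : ℤ, ![a, b] + ![e, f] = ![a + e, b + f] := by simp
  have hbox : ∀ e f : ℤ, -1 ≤ e → e ≤ 1 → -1 ≤ f → f ≤ 1 → ![e, f] ∈ box := by
    intro e f h1 h2 h3 h4
    simp [mem_box, Fin.forall_fin_two, *]
  have key := diagrams_vertical (g := g) (h := g') hz hw fun e he he' => by
    have hb := hbox e 0 he he' (by norm_num) (by norm_num)
    rw [← hxz _ hb, ← hyw _ hb, hadd, add_zero, h]
  have hb1 := hbox 0 (-1) (by norm_num) (by norm_num) (by norm_num) (by norm_num)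
  have hb2 := hbox 0 1 (by norm_num) (by norm_num) (by norm_num) (by norm_num)
  rwa [← hxz _ hb1, ← hyw _ hb1, ← hxz _ hb2, ← hyw _ hb2, hadd, hadd, add_zero,
    ← sub_eq_add_neg] at key

theorem diagramShift_rows_below {x y : Z2 → Cell P N n}
    (hx : x ∈ (diagramShift lab n).carrier) (hy : y ∈ (diagramShift lab n).carrier) {b : ℤ}
    (h : ∀ a, x ![a, b] = y ![a, b]) {c : ℤ} (hc : c ≤ b) (a : ℤ) : x ![a, c] = y ![a, c] := by
  induction c, hc using Int.leInductionDown generalizing a with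
  | base => exact h a
  | pred c _ ih => exact (diagramShift_adjacent_rows hx hy ih a).1

theorem diagramShift_eq_of_row {x y : Z2 → Cell P N n}
    (hx : x ∈ (diagramShift lab n).carrier) (hy : y ∈ (diagramShift lab n).carrier)
    (h : ∀ a, x ![a, 0] = y ![a, 0]) : x = y := by
  funext v
  rw [← vec_eta v]
  generalize v 0 = a, v 1 = c
  rcases le_total c 0 with hc | hc
  · exact diagramShift_rows_below hx hy h hc a
  · induction c, hc using Int.leInduction generalizing a with
    | base => exact h a
    | succ c _ ih => exact (diagramShift_adjacent_rows hx hy ih a).2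

/-- The time of the diagrams runs upward, but as the dynamics is reversible the subshift is also
deterministic southward. -/
theorem deterministic_diagramShift : Deterministic (diagramShift lab n) := by
  refine ⟨![0, -1], by simp [IsDirection], 1, ?_, ?_⟩
  · ext i
    fin_cases i <;> simp [quarterTurn]
  · have htr : ∀ z : Z2 → Cell P N n, transform 1 z = z := fun z => by
      funext v; simp [transform]
    rintro x _ ⟨⟨y, hy, rfl⟩, hxy⟩ _ ⟨⟨z, hz, rfl⟩, hxz⟩
    rw [htr] at hxy hxz ⊢
    rw [htr]
    have hup : ∀ v ∈ upperHalf, y v = z v := fun v hv => (hxy v hv).symm.trans (hxz v hv)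
    funext v
    rcases le_total (v 1) 1 with hv | hv
    · rw [← vec_eta v]
      exact diagramShift_rows_below hy hz
        (fun a => hup ![a, 1] (by simp [upperHalf])) hv (v 0)
    · exact hup v hv

theorem row_mem_rowShift {x : Z2 → Cell P N n} (hx : x ∈ (diagramShift lab n).carrier) :
    (fun j => x ![j, 0]) ∈ (rowShift lab n).carrier := by
  refine mem_windowHull.2 fun g => ?_
  obtain ⟨z, hz, h, hxz⟩ := mem_windowHull.1 hx ![g, 0]
  refine ⟨_, ⟨z, hz, h 1, rfl⟩, h 0, fun u hu => ?_⟩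
  rw [Finset.mem_Icc] at hu
  have := hxz ![u, 0] (by simp [mem_box, Fin.forall_fin_two]; omega)
  rw [← vec_eta h] at this
  simpa using this

theorem countable_rowShift [Finite P] [NeZero N] : (rowShift lab n).carrier.Countable := by
  have hadj : ∀ y ∈ (rowShift lab n).carrier, ∀ j,
      (y (j + 1)).phase = (y j).phase + 1 ∧ MarkAdj (y j).origin (y (j + 1)).origin ∧
        ∀ i, MarkAdj ((y j).walls i) ((y (j + 1)).walls i) := by
    intro y hy j
    obtain ⟨_, ⟨_, ⟨k, p, -, -, rfl⟩, b, rfl⟩, h, hyh⟩ := mem_windowHull.1 hy j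
    have h0 := hyh 0 (by simp)
    have h1 := hyh 1 (by simp)
    rw [add_zero] at h0
    rw [h0, h1]
    refine ⟨by simp [diagram, cellAt], by simpa [diagram, cellAt] using markAdj_mark 0 () h, ?_⟩
    intro i
    simp only [diagram, cellAt, wallAt, Matrix.cons_val_zero, Matrix.cons_val_one, add_zero]
    split_ifs
    · exact markAdj_mark _ _ _
    · exact markAdj_true
  -- A row is determined by its phase at `0` and its sequences of marks, of which there are
  -- countably many each.
  let code : (ℤ → Cell P N n) → ZMod N × (ℤ → Bool ⊕ Unit) × (Fin n → ℤ → Bool ⊕ (Bool × P)) :=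
    fun y => ((y 0).phase, fun j => (y j).origin, fun i j => (y j).walls i)
  have hcode : Set.InjOn code (rowShift lab n).carrier := by
    intro y hy z hz hyz
    simp only [code, Prod.mk.injEq, funext_iff] at hyz
    obtain ⟨h1, h2, h3⟩ := hyz
    have hphase : ∀ j, (y j).phase = (z j).phase := by
      intro j
      induction j using Int.induction_on with
      | zero => exact h1
      | succ j ih => rw [(hadj y hy _).1, (hadj z hz _).1, ih]
      | pred j ih =>
        have hy' := (hadj y hy (-j - 1)).1
        have hz' := (hadj z hz (-j - 1)).1
        rw [sub_add_cancel] at hy' hz'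
        rw [hy', hz'] at ih
        exact add_right_cancel ih
    exact funext fun j => Cell.ext (hphase j) (h2 j) (funext fun i => h3 i j)
  refine Set.countable_of_injective_of_countable_image hcode (Set.Countable.mono ?_
    ((Set.countable_univ (α := ZMod N)).prod (countable_setOf_markAdj.prod
      (Set.countable_pi fun _ : Fin n => countable_setOf_markAdj))))
  rintro _ ⟨y, hy, rfl⟩
  exact ⟨Set.mem_univ _, fun j => (hadj y hy j).2.1, fun i j => (hadj y hy j).2.2 i⟩

theorem countable_diagramShift [Finite P] [NeZero N] : (diagramShift lab n).carrier.Countable := by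
  refine Set.countable_of_injective_of_countable_image
    (f := fun (x : Z2 → Cell P N n) (j : ℤ) => x ![j, 0]) (fun x hx y hy hxy => ?_)
    ((countable_rowShift (lab := lab) (n := n)).mono ?_)
  · exact diagramShift_eq_of_row hx hy fun a => congrFun hxy a
  · rintro _ ⟨x, hx, rfl⟩
    exact row_mem_rowShift hx

theorem rowsInCountableSFT_diagramShift [Finite P] [NeZero N] :
    RowsInCountableSFT (diagramShift lab n) :=
  ⟨rowShift lab n, isSFT_windowHull _ _, countable_rowShift,
    Set.image_subset_iff.2 fun _ hx => row_mem_rowShift hx⟩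

/-! ### The subpattern order of the diagrams -/

/-- A diagram shows the colour of its outermost wall, and otherwise only smaller colours. -/
theorem le_of_patternsOf_subset {k k' : ℕ} {p p' : P} (hk : 0 < k) (hkn : k ≤ n)
    (h : patternsOf (diagram lab n k p) ⊆ patternsOf (diagram lab n k' p')) : p ≤ p' := by
  classical
  let c : Cell P N n := diagram lab n k p 0
  obtain ⟨g, hg⟩ := @h
    { config := fun v => if v = 0 then c else default
      support := {0}
      condition := fun v hv => if_neg (by simpa using hv) }
    ⟨0, fun v hv => by
      obtain rfl : v = 0 := by simpa using hv
      simp [c]⟩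
  have h0 : diagram lab n k' p' g = c := by simpa using hg 0 (by simp)
  have h1 := congrFun (congrArg Cell.walls h0) ⟨k - 1, by omega⟩
  have h2 : c.walls ⟨k - 1, by omega⟩ = .inr (false, p) := by
    refine wallAt_eq_inr_iff.2 ⟨by simp; omega, by simp [State.init], ?_⟩
    rw [colour_last (by simp; omega)]
    simp [State.init]
  rw [h2] at h1
  have h3 := (wallAt_eq_inr_iff.1 h1).2.2
  exact (Prod.ext_iff.1 h3).2.symm.trans_le (colour_le _ _ _ _)

/-- If the outermost of `k + 1` walls is at the distance `D`, then the lower `k` walls, starting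
from their initial state, form the diagram of a system of `k` walls for as long as the distance
permits; the colour of this system is the one that is selected by the outermost wall. -/
theorem cellAt_evolve_put {k D : ℕ} {p : P} (hk : 0 < k) (hkn : k + 1 ≤ n) (t : ℤ) (a : ℤ)
    (h : |a| + |t| < D) :
    cellAt lab n (k + 1) p ((State.evolve (k + 1) ^ t) (State.init.put k D true)) a =
      cellAt lab n k (sel lab p (D : ZMod N)) ((State.evolve k ^ t) State.init) a := by
  have hs : (State.init.put k D true).Sorted (k + 1) := fun i hi => by
    simp [State.put, State.init, Function.update_apply, show i ≠ k by omega]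
  induction t using Int.induction_on generalizing a with
  | zero =>
    simp only [zpow_zero, Equiv.Perm.one_apply]
    have ha : a < D := by have := le_abs_self a; simp at h; omega
    ext1
    · rfl
    · rfl
    funext i
    change wallAt lab _ _ _ i a = wallAt lab _ _ _ i a
    rcases lt_trichotomy (i : ℕ) k with hi | hi | hi
    · have hc : colour lab (k + 1) p (State.init.put k D true).pos i =
          colour lab k (sel lab p (D : ZMod N)) State.init.pos i := by
        refine colour_congr (L := k - 1) (by omega) (by omega) ?_ (fun j hj => ?_) (by omega)
        · rw [colour_of_lt (by omega), colour_last (by omega), colour_last (by omega)]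
          simp [State.put, show k - 1 + 1 = k by omega]
        · simp [State.put, show j ≠ k by omega]
      rw [wallAt, wallAt, if_pos hi, if_pos (by omega), hc]
      simp [State.put, State.init, hi.ne]
    · rw [wallAt, wallAt, if_pos (by omega), if_neg (by omega), hi, mark_of_lt]
      simpa [State.put] using ha
    · rw [wallAt, wallAt, if_neg (by omega), if_neg (by omega)]
  | succ t ih =>
    simp only [add_comm (t : ℤ), zpow_add, zpow_one, Equiv.Perm.mul_apply]
    refine cellAt_evolve_congr (by omega) hk hkn (by omega) (hs.evolve_zpow _)
      ((State.sorted_init k).evolve_zpow _) fun e he he' => ih _ ?_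
    grind
  | pred t ih =>
    simp only [sub_eq_neg_add _ (1 : ℤ), zpow_add _ (-1 : ℤ), zpow_neg_one, Equiv.Perm.mul_apply]
    refine cellAt_evolve_inv_congr (by omega) hk hkn (by omega) (hs.evolve_zpow _)
      ((State.sorted_init k).evolve_zpow _) fun e he he' => ih _ ?_
    grind

variable [NeZero N]

theorem patternsOf_diagram_succ (hlab : Function.Surjective lab) {k : ℕ} {p q : P} (hqp : q ≤ p)
    (hk : 0 < k) (hkn : k + 1 ≤ n) :
    patternsOf (diagram lab n k q) ⊆ patternsOf (diagram lab n (k + 1) p) := by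
  rintro w ⟨g, hg⟩
  obtain ⟨r, rfl⟩ := hlab q
  obtain ⟨R, hR⟩ : ∃ R : ℕ, ∀ v ∈ w.support, |(g + v) 0| + |(g + v) 1| ≤ R := by
    refine ⟨w.support.sup fun v => (|(g + v) 0| + |(g + v) 1|).toNat, fun v hv => ?_⟩
    have := Finset.le_sup (f := fun v => (|(g + v) 0| + |(g + v) 1|).toNat) hv
    omega
  -- A distance beyond the pattern at which the outermost wall selects the colour `lab r`.
  let D := r.val + N * (R + 1)
  have hDR : R < D := by
    have := Nat.le_mul_of_pos_left (R + 1) (NeZero.pos N)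
    omega
  have hD : (D : ZMod N) = r := by simp [D]
  obtain ⟨T, hT⟩ := State.sameCycle_init_put (k := k) (D := D) (by omega)
  refine ⟨g + ![0, T], fun v hv => ?_⟩
  rw [← hg v hv]
  have h0 : (g + ![0, T] + v) 0 = (g + v) 0 := by
    simp only [Pi.add_apply, Matrix.cons_val_zero, add_zero]
  have h1 : (g + ![0, T] + v) 1 = (g + v) 1 + T := by
    simp only [Pi.add_apply, Matrix.cons_val_one, Matrix.cons_val_zero]
    ring
  rw [diagram, diagram, h0, h1, zpow_add, Equiv.Perm.mul_apply, hT,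
    cellAt_evolve_put hk hkn _ _ (lt_of_le_of_lt (hR v hv) (by exact_mod_cast hDR)), hD,
    sel_eq lab hqp]

theorem patternsOf_diagram_subset (hlab : Function.Surjective lab) {k k' : ℕ} {p q : P}
    (hqp : q ≤ p) (hk : 0 < k) (hkk' : k < k') (hkn : k' ≤ n) :
    patternsOf (diagram lab n k q) ⊆ patternsOf (diagram lab n k' p) := by
  induction k', hkk' using Nat.le_induction with
  | base => exact patternsOf_diagram_succ hlab hqp hk hkn
  | succ k' h ih =>
    exact (ih (by omega)).trans (patternsOf_diagram_succ hlab le_rfl (by omega) hkn)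

/-- The element `p` is represented by the diagram with the outermost colour `p` whose number of
walls is the number of elements below `p`. -/
theorem nonempty_orderEmbedding_SP [Finite P] (hlab : Function.Surjective lab) :
    Nonempty (P ↪o SP (diagramShift lab (Nat.card P))) := by
  let level : P → ℕ := fun p => (Set.Iic p).ncard
  have hpos : ∀ p, 0 < level p := fun p => (Set.ncard_pos).2 ⟨p, le_rfl⟩
  have hle : ∀ p, level p ≤ Nat.card P := fun p => Set.ncard_le_card _
  let f : P → Points (diagramShift lab (Nat.card P)) := fun p =>
    ⟨diagram lab _ (level p) p, subset_windowHull _ _ ⟨level p, p, hpos p, hle p, rfl⟩⟩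
  refine ⟨OrderEmbedding.ofMapLEIff (fun p => toAntisymmetrization (· ≤ ·) (f p)) fun q p => ?_⟩
  rw [toAntisymmetrization_le_toAntisymmetrization_iff]
  refine ⟨le_of_patternsOf_subset (hpos q) (hle q), fun hqp => ?_⟩
  rcases hqp.eq_or_lt with rfl | hlt
  · exact le_rfl
  · exact patternsOf_diagram_subset hlab hqp (hpos q)
      (Set.ncard_lt_ncard (Set.Iic_ssubset_Iic.2 hlt)) (hle p)

end Diagrams

theorem conjugate_refl {S G : Type*} [TopologicalSpace S] [AddMonoid G] (X : Subshift S G) :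
    Conjugate X X :=
  ⟨id, ⟨continuous_id, fun _ _ => rfl⟩, Function.bijective_id⟩

end SFTPoset

theorem mainTheorem4 (P : Type*) [PartialOrder P] [Finite P] :
    ∃ (S : Type) (_ : Finite S) (_ : Inhabited S) (_ : TopologicalSpace S)
      (_ : DiscreteTopology S)
      (X : SymbolicDynamics.FullShift.Subshift S SFTPoset.Z2),
      SFTPoset.IsSFT X ∧
      X.carrier.Countable ∧
      SFTPoset.Deterministic X ∧
      SFTPoset.HasPProperty X ∧
      SFTPoset.RowsInCountableSFT X ∧
      Nonempty (P ↪o SFTPoset.SP X) := by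
  -- A greatest element is added because at least one colour is needed. The colours are taken in
  -- `Type`, where the alphabet has to be.
  obtain ⟨m, ⟨e⟩⟩ := Finite.exists_equiv_fin (WithTop P)
  obtain ⟨Q, ⟨e⟩⟩ : ∃ Q : Type, Nonempty (WithTop P ≃ Q) := ⟨Fin m, ⟨e⟩⟩
  let _ : PartialOrder Q := PartialOrder.lift e.symm e.symm.injective
  have : Finite Q := Finite.of_equiv _ e
  have : Nonempty Q := ⟨e ⊤⟩
  have : NeZero (Nat.card Q) := ⟨Nat.card_pos.ne'⟩
  obtain ⟨lab⟩ : Nonempty (ZMod (Nat.card Q) ≃ Q) :=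
    ⟨(Finite.equivFinOfCardEq (Nat.card_zmod _)).trans (Finite.equivFin Q).symm⟩
  obtain ⟨φ⟩ := SFTPoset.nonempty_orderEmbedding_SP lab.surjective
  let ψ : WithTop P ↪o Q := ⟨e.toEmbedding, fun {a b} => by
    change e.symm (e a) ≤ e.symm (e b) ↔ _
    simp⟩
  exact ⟨SFTPoset.Cell Q (Nat.card Q) (Nat.card Q), inferInstance, inferInstance, inferInstance,
    inferInstance, SFTPoset.diagramShift lab (Nat.card Q), SFTPoset.isSFT_windowHull _ _,
    SFTPoset.countable_diagramShift, SFTPoset.deterministic_diagramShift,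
    ⟨_, inferInstance, inferInstance, inferInstance, inferInstance, _,
      SFTPoset.conjugate_refl _, SFTPoset.rowsInCountableSFT_diagramShift⟩,
    SFTPoset.rowsInCountableSFT_diagramShift,
    ⟨(WithTop.coeOrderHom.trans ψ).trans φ⟩⟩
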